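/- **Setting.** Let $\mathbb F$ be an algebraically closed field. The degree of a polynomial row vector, or of a polynomial matrix, is the largest degree of its entries; a linear polynomial matrix is one whose entries have degree at most $1$. For a polynomial matrix $G(\lambda)$ of degree at most $g$ put $\operatorname{rev}_gG(\lambda)=\lambda^gG(1/\lambda)$. A minimal basis of a subspace $\mathcal V\subseteq\mathbb F(\lambda)^{1\times n}$ is a basis of $\mathcal V$ consisting of polynomial vectors whose sum of degrees is least among all polynomial bases of $\mathcal V$; the ordered list of its degrees depends only on $\mathcal V$ and is the list of minimal indices of $\mathcal V$. The left minimal bases and left minimal indices of a rational matrix $G(\lambda)$ are those of its left null-space $\{y(\lambda)^T : y(\lambda)^TG(\lambda)=0\}$. A polynomial matrix is called a minimal basis if its rows are a minimal basis of their span. Two minimal bases $K(\lambda)\in\mathbb F[\lambda]^{k\times c}$ and $N(\lambda)\in\mathbb F[\lambda]^{q\times c}$ are dual if $k+q=c$ and $K(\lambda)N(\lambda)^T=0$. A linear polynomial matrix $L(\lambda)=\begin{bmatrix}M(\lambda)\\K(\lambda)\end{bmatrix}$ is a strong block minimal basis pencil if $K(\lambda)$ is a minimal basis (possibly with no rows)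 all of whose row degrees are $1$, and a minimal basis dual to $K(\lambda)$ has all its row degrees equal; it is associated with $P(\lambda)$, through the minimal basis $N(\lambda)$ dual to $K(\lambda)$, if $M(\lambda)N(\lambda)^T=P(\lambda)$. **Theorem.** Let $R(\lambda)=D(\lambda)+C(\lambda)A(\lambda)^{-1}B(\lambda)\in\mathbb F(\lambda)^{p\times m}$ with polynomial matrices $A(\lambda)\in\mathbb F[\lambda]^{n\times n}$, $\det A(\lambda)\not\equiv0$, $B(\lambda)\in\mathbb F[\lambda]^{n\times m}$, $C(\lambda)\in\mathbb F[\lambda]^{p\times n}$ and $D(\lambda)\in\mathbb F[\lambda]^{p\times m}$. Let $$L_A(\lambda)=\begin{bmatrix}M_A(\lambda)\\K_A(\lambda)\end{bmatrix},\qquad L_D(\lambda)=\begin{bmatrix}M_D(\lambda)\\K_D(\lambda)\end{bmatrix}$$ be strong block minimal basis pencils associated with $A(\lambda)$ and $D(\lambda)$ through minimal bases $N_A(\lambda)$ (with $n$ rows) and $N_D(\lambda)$ (with $m$ rows) dual to $K_A(\lambda)$ and $K_D(\lambda)$: $M_AN_A^T=A$ and $M_DN_D^T=D$. Put $\rho_i=\deg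 N_i(\lambda)$ for $i\in\{A,D\}$. Let $M_B(\lambda)$, $M_C(\lambda)$ be linear polynomial matrices with $M_B(\lambda)N_D(\lambda)^T=B(\lambda)$ and $M_C(\lambda)N_A(\lambda)^T=C(\lambda)$. Consider the linear polynomial system matrix $$\mathcal L(\lambda)=\left[\begin{array}{c|c}M_A(\lambda)&M_B(\lambda)\\K_A(\lambda)&0\\\hline -M_C(\lambda)&M_D(\lambda)\\0&K_D(\lambda)\end{array}\right]$$ with state matrix $L_A(\lambda)$, and its transfer function matrix $$\widehat R(\lambda)=\begin{bmatrix}M_D(\lambda)\\K_D(\lambda)\end{bmatrix}+\begin{bmatrix}M_C(\lambda)\\0\end{bmatrix}L_A(\lambda)^{-1}\begin{bmatrix}M_B(\lambda)\\0\end{bmatrix}.$$ Assume that $$\operatorname{rank}\begin{bmatrix}A(\lambda_0)&B(\lambda_0)\end{bmatrix}=n\ \text{ for all }\lambda_0\in\mathbb F,\qquad \operatorname{rank}\begin{bmatrix}\operatorname{rev}_{\rho_A+1}A(0)&\operatorname{rev}_{\rho_D+1}B(0)\end{bmatrix}=n.$$ Then: (a) If $\{z_i(\lambda)^T\}_{i=1}^t$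 is a left minimal basis of $\mathcal L(\lambda)$, partitioned as $z_i(\lambda)^T=\begin{bmatrix}y_i(\lambda)^T&x_i(\lambda)^T\end{bmatrix}$ conformably with the two block rows of $\mathcal L(\lambda)$ separated by the line, and $x_i(\lambda)^T=\begin{bmatrix}u_i(\lambda)^T&w_i(\lambda)^T\end{bmatrix}$ with $u_i(\lambda)^T$ of length $p$, then $\{x_i(\lambda)^T\}_{i=1}^t$ is a left minimal basis of $\widehat R(\lambda)$ and $\{u_i(\lambda)^T\}_{i=1}^t$ is a left minimal basis of $R(\lambda)$. (b) The left minimal indices of $\mathcal L(\lambda)$, of $\widehat R(\lambda)$ and of $R(\lambda)$ coincide: a list $\eta_1\le\cdots\le\eta_t$ is the list of left minimal indices of $\mathcal L(\lambda)$ if and only if it is that of $\widehat R(\lambda)$, and if and only if it is that of $R(\lambda)$. -/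

import Mathlib

/-!  Matrix polynomials are matrices over `Polynomial F`, rational matrices are matrices over
`RatFunc F`, and a finite family of (row) vectors is the matrix that has them as its rows. -/

namespace RationalMatrix

open Matrix

variable {F : Type*} [Field F]

/-- A polynomial matrix regarded as a rational matrix. -/
noncomputable def toRat {α β : Type*} (G : Matrix α β (Polynomial F)) : Matrix α β (RatFunc F) :=
  G.map (algebraMap (Polynomial F) (RatFunc F))

/-- The constant matrix `G(x)`. -/
noncomputable def evalAt {α β : Type*} (x : F) (G : Matrix α β (Polynomial F)) : Matrix α β F :=
  G.map (Polynomial.eval x)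

/-- The degree of the `i`-th row: the largest degree of its entries. -/
noncomputable def rowDegree {α β : Type*} [Fintype β] (G : Matrix α β (Polynomial F)) (i : α) : ℕ :=
  Finset.univ.sup fun j => (G i j).natDegree

/-- The degree of a polynomial matrix: the largest degree of its entries. -/
noncomputable def matDegree {α β : Type*} [Fintype α] [Fintype β]
    (G : Matrix α β (Polynomial F)) : ℕ :=
  Finset.univ.sup fun i => rowDegree G i

/-- A linear polynomial matrix (a pencil): every entry has degree at most one. -/
def IsPencil {α β : Type*} (G : Matrix α β (Polynomial F)) : Prop :=
  ∀ i j, (G i j).natDegree ≤ 1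

/-- The `g`-reversal `λ ^ g * G(1/λ)` of a polynomial matrix of degree at most `g`:
the coefficient of `λ ^ k` becomes the coefficient of `λ ^ (g - k)`. -/
noncomputable def rev {α β : Type*} (g : ℕ) (G : Matrix α β (Polynomial F)) :
    Matrix α β (Polynomial F) :=
  G.map (Polynomial.reflect g)

/-- The rows of `Z` form a basis of the rational subspace `V` (polynomial since `Z` is). -/
def IsPolynomialBasis {κ ι : Type*} (V : Submodule (RatFunc F) (ι → RatFunc F))
    (Z : Matrix κ ι (Polynomial F)) : Prop :=
  LinearIndependent (RatFunc F) (toRat Z).row ∧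
    Submodule.span (RatFunc F) (Set.range (toRat Z).row) = V

/-- The rows of `Z` form a minimal basis of the rational subspace `V`: a polynomial basis whose
sum of degrees is least among all polynomial bases of `V` (these all have the same size). -/
def IsMinimalBasisOf {κ ι : Type*} [Fintype κ] [Fintype ι]
    (V : Submodule (RatFunc F) (ι → RatFunc F)) (Z : Matrix κ ι (Polynomial F)) : Prop :=
  IsPolynomialBasis V Z ∧
    ∀ Y : Matrix κ ι (Polynomial F), IsPolynomialBasis V Y →
      ∑ i, rowDegree Z i ≤ ∑ i, rowDegree Y i

/-- A polynomial matrix is a minimal basis if its rows are a minimal basis of their span. -/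
def IsMinimalBasis {κ ι : Type*} [Fintype κ] [Fintype ι] (Z : Matrix κ ι (Polynomial F)) : Prop :=
  IsMinimalBasisOf (Submodule.span (RatFunc F) (Set.range (toRat Z).row)) Z

/-- `η 0 ≤ η 1 ≤ ...` are the minimal indices of `V`: `V` has a minimal basis, and the ordered list
of the degrees of any minimal basis of `V` is `η`. -/
def IsMinimalIndices {ι : Type*} [Fintype ι] (V : Submodule (RatFunc F) (ι → RatFunc F))
    {t : ℕ} (η : Fin t → ℕ) : Prop :=
  Monotone η ∧ (∃ Z : Matrix (Fin t) ι (Polynomial F), IsMinimalBasisOf V Z) ∧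
    ∀ Z : Matrix (Fin t) ι (Polynomial F), IsMinimalBasisOf V Z →
      ∃ σ : Equiv.Perm (Fin t), ∀ i, rowDegree Z (σ i) = η i

/-- The left null-space of a rational matrix: all row vectors `y` with `y G = 0`. -/
noncomputable def leftNullspace {α β : Type*} [Fintype α] (G : Matrix α β (RatFunc F)) :
    Submodule (RatFunc F) (α → RatFunc F) :=
  LinearMap.ker G.vecMulLinear

/-- The rows of `Z` are a left minimal basis of the rational matrix `G`. -/
def IsLeftMinimalBasis {κ α β : Type*} [Fintype κ] [Fintype α]
    (G : Matrix α β (RatFunc F)) (Z : Matrix κ α (Polynomial F)) : Prop :=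
  IsMinimalBasisOf (leftNullspace G) Z

/-- `η` lists the left minimal indices of the rational matrix `G` in increasing order. -/
def IsLeftMinimalIndices {α β : Type*} [Fintype α] (G : Matrix α β (RatFunc F))
    {t : ℕ} (η : Fin t → ℕ) : Prop :=
  IsMinimalIndices (leftNullspace G) η

/-- `K` and `N` are dual minimal bases. -/
structure IsDualMinimalBasis {κ ν ι : Type*} [Fintype κ] [Fintype ν] [Fintype ι]
    (K : Matrix κ ι (Polynomial F)) (N : Matrix ν ι (Polynomial F)) : Prop where
  minimal_left : IsMinimalBasis K
  minimal_right : IsMinimalBasis N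
  card_add_card : Fintype.card κ + Fintype.card ν = Fintype.card ι
  mul_transpose : K * Nᵀ = 0

/-- The block column with blocks `M` and `K` is a (one block column) strong block minimal basis
pencil: it is a pencil, `K` is a minimal basis all of whose row degrees equal one, and `K` has a
dual minimal basis whose row degrees are all equal. -/
structure IsStrongBlockMinimalBasisPencil {α κ ι : Type*} [Fintype κ] [Fintype ι]
    (M : Matrix α ι (Polynomial F)) (K : Matrix κ ι (Polynomial F)) : Prop where
  pencil : IsPencil (fromRows M K)
  minimal : IsMinimalBasis K
  rowDegree_eq_one : ∀ i, rowDegree K i = 1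
  dual_rowDegree_eq : ∃ (q : ℕ) (N : Matrix (Fin q) ι (Polynomial F)),
    IsDualMinimalBasis K N ∧ ∀ i j, rowDegree N i = rowDegree N j

/-- The polynomial system matrix with blocks `A`, `B`, `-C`, `D` and state matrix `A`. -/
noncomputable def systemMatrix {ν α β : Type*} (A : Matrix ν ν (Polynomial F)) (B : Matrix ν β (Polynomial F))
    (C : Matrix α ν (Polynomial F)) (D : Matrix α β (Polynomial F)) :
    Matrix (ν ⊕ α) (ν ⊕ β) (Polynomial F) :=
  fromBlocks A B (-C) D

/-- The transfer function matrix `D + C A⁻¹ B` of `systemMatrix A B C D`, for `A` nonsingular. -/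
noncomputable def transferFunction {ν α β : Type*} [Fintype ν] [DecidableEq ν]
    (A : Matrix ν ν (Polynomial F)) (B : Matrix ν β (Polynomial F))
    (C : Matrix α ν (Polynomial F)) (D : Matrix α β (Polynomial F)) : Matrix α β (RatFunc F) :=
  toRat D + toRat C * (toRat A)⁻¹ * toRat B

end RationalMatrix

open RationalMatrix

/-! Selecting the coordinates `x`, respectively `u`, maps the left null-space of `𝓛` isomorphically
onto that of `R̂`, respectively `R`. Such a selection carries minimal bases to minimal bases, in
both directions and with the same degrees, once the deleted coordinates of a vector are polynomials
of no larger degree whenever the selected ones are polynomials.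

For a block column `[M; K]` the deleted coordinates `w` solve `w K = -u M`. A minimal basis `K` with
dual `N` has the left null-space of `Nᵀ` as its row space, so this is solvable exactly when
`u M Nᵀ = 0`; and it has full row rank at every finite point and, after scaling its rows, at
infinity, so `w` is polynomial of no larger degree than `u` if no row of `K` has smaller degree than
`M`. A row permutation turns `𝓛` into such a block column, with `K = diag(K_A, K_D)` and
`M Nᵀ = [A B; -C D]`. The state coordinates of that system matrix solve `y [A B] = u [C -D]`, where
the two rank conditions play the same role for `[A B]`. -/

namespace RationalMatrix

open Matrix Polynomial

variable {F : Type*} [Field F] {α β γ κ κ' ν ν' ι ι' : Type*}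

/-! ### Polynomial and rational vectors -/

/-- A polynomial vector regarded as a rational vector. -/
noncomputable def toRatVec : (α → F[X]) →ₗ[F[X]] (α → RatFunc F) :=
  (Algebra.linearMap F[X] (RatFunc F)).compLeft α

lemma toRatVec_injective : Function.Injective (toRatVec : (α → F[X]) →ₗ[F[X]] α → RatFunc F) :=
  (IsFractionRing.injective F[X] (RatFunc F)).comp_left

lemma toRatVec_vecMul [Fintype α] (p : α → F[X]) (G : Matrix α β F[X]) :
    toRatVec (p ᵥ* G) = toRatVec p ᵥ* toRat G :=
  funext fun j => (algebraMap F[X] (RatFunc F)).map_vecMul G p j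

lemma toRat_mul [Fintype α] (G : Matrix κ α F[X]) (H : Matrix α β F[X]) :
    toRat (G * H) = toRat G * toRat H :=
  Matrix.map_mul

lemma toRat_zero : toRat (0 : Matrix α β F[X]) = 0 :=
  Matrix.map_zero _ (map_zero _)

lemma toRat_fromRows (G : Matrix α ι F[X]) (H : Matrix β ι F[X]) :
    toRat (fromRows G H) = fromRows (toRat G) (toRat H) :=
  fromRows_map _ _ _

lemma toRat_fromBlocks (A : Matrix α β F[X]) (B : Matrix α ι F[X]) (C : Matrix κ β F[X])
    (D : Matrix κ ι F[X]) :
    toRat (fromBlocks A B C D) = fromBlocks (toRat A) (toRat B) (toRat C) (toRat D) :=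
  fromBlocks_map _ _ _ _ _

lemma det_toRat [Fintype α] [DecidableEq α] (A : Matrix α α F[X]) :
    (toRat A).det = algebraMap F[X] (RatFunc F) A.det :=
  ((algebraMap F[X] (RatFunc F)).map_det A).symm

lemma det_toRat_ne_zero_iff [Fintype α] [DecidableEq α] {A : Matrix α α F[X]} :
    (toRat A).det ≠ 0 ↔ A.det ≠ 0 := by
  rw [det_toRat, map_ne_zero_iff _ (IsFractionRing.injective F[X] (RatFunc F))]

/-! ### Degrees -/

lemma natDegree_le_rowDegree [Fintype β] (G : Matrix α β F[X]) (i : α) (j : β) :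
    (G i j).natDegree ≤ rowDegree G i :=
  Finset.le_sup (f := fun j => (G i j).natDegree) (Finset.mem_univ j)

lemma rowDegree_le_iff [Fintype β] {G : Matrix α β F[X]} {i : α} {d : ℕ} :
    rowDegree G i ≤ d ↔ ∀ j, (G i j).degree < (d + 1 : ℕ) := by
  simp only [rowDegree, Finset.sup_le_iff, Finset.mem_univ, true_implies,
    natDegree_le_iff_degree_le, degree_le_iff_coeff_zero, degree_lt_iff_coeff_zero, Nat.cast_lt,
    Nat.succ_le_iff]

lemma natDegree_le_matDegree [Fintype α] [Fintype β] (G : Matrix α β F[X]) (i : α) (j : β) :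
    (G i j).natDegree ≤ matDegree G :=
  (natDegree_le_rowDegree G i j).trans (Finset.le_sup (f := rowDegree G) (Finset.mem_univ i))

lemma degree_vecMul_lt_of_natDegree_add_lt [Fintype α] {p : α → F[X]} {G : Matrix α β F[X]}
    {j : β} {e : α → ℕ} {d : ℕ} (hG : ∀ i, (G i j).natDegree ≤ e i)
    (hp : ∀ i, p i ≠ 0 → (p i).natDegree + e i < d) : ((p ᵥ* G) j).degree < d := by
  rw [← mem_degreeLT]
  refine Submodule.sum_mem _ fun i _ => ?_
  by_cases hi : p i = 0
  · rw [hi, zero_mul]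
    exact zero_mem _
  · rw [mem_degreeLT]
    refine degree_le_natDegree.trans_lt (Nat.cast_lt.2 ?_)
    exact (natDegree_mul_le_of_le le_rfl (hG i)).trans_lt (hp i hi)

lemma degree_vecMul_lt [Fintype α] {p : α → F[X]} {G : Matrix α β F[X]} {j : β} {d e : ℕ}
    (hp : ∀ i, (p i).degree < d) (hG : ∀ i, (G i j).natDegree ≤ e) :
    ((p ᵥ* G) j).degree < (d + e : ℕ) :=
  degree_vecMul_lt_of_natDegree_add_lt hG fun i hi =>
    Nat.add_lt_add_right ((natDegree_lt_iff_degree_lt hi).2 (hp i)) e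

lemma natDegree_mul_transpose_le [Fintype ν] [Fintype ι] {M : Matrix α ι F[X]} {ℓ : ℕ}
    (hM : ∀ i j, (M i j).natDegree ≤ ℓ) (N : Matrix ν ι F[X]) (i : α) (j : ν) :
    ((M * Nᵀ) i j).natDegree ≤ matDegree N + ℓ :=
  natDegree_sum_le_of_forall_le _ _ fun k _ =>
    (natDegree_mul_le_of_le (hM i k) (natDegree_le_matDegree N j k)).trans_eq (add_comm _ _)

/-! ### Minimal bases -/

lemma IsPolynomialBasis.of_le_span [Finite κ] [Finite ι]
    {V : Submodule (RatFunc F) (ι → RatFunc F)} {Z Y : Matrix κ ι F[X]}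
    (hZ : IsPolynomialBasis V Z)
    (hV : V ≤ Submodule.span (RatFunc F) (Set.range (toRat Y).row)) : IsPolynomialBasis V Y := by
  cases nonempty_fintype κ
  have hcard : Fintype.card κ = Module.finrank (RatFunc F) V := by
    rw [← hZ.2]
    exact linearIndependent_iff_card_eq_finrank_span.1 hZ.1
  constructor
  · rw [linearIndependent_iff_card_le_finrank_span, hcard]
    exact Submodule.finrank_mono hV
  · refine (Submodule.eq_of_le_of_finrank_le hV ?_).symm
    rw [← hcard]
    exact finrank_range_le_card _

/-- Otherwise `s` could replace the `i`-th row of `K`, since it depends on that row. -/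
lemma IsMinimalBasis.exists_rowDegree_le_degree [Fintype κ] [Fintype ι] {K : Matrix κ ι F[X]}
    (hK : IsMinimalBasis K) {p : κ → F[X]} {d : F[X]} {s : ι → F[X]} (h : p ᵥ* K = d • s) {i : κ}
    (hi : p i ≠ 0) : ∃ j, (rowDegree K i : WithBot ℕ) ≤ (s j).degree := by
  classical
  by_contra! hs
  set Y := K.updateRow i s
  set S := Submodule.span (RatFunc F) (Set.range (toRat Y).row)
  have hYi : Y.row i = s := updateRow_self
  have hYk {k : κ} (hk : k ≠ i) : Y.row k = K.row k := updateRow_ne hk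
  have hmem (k : κ) : toRatVec (Y.row k) ∈ S := Submodule.subset_span ⟨k, rfl⟩
  have hsum : ∑ k, p k • toRatVec (K.row k) = d • toRatVec (Y.row i) := by
    rw [hYi, ← map_smul, ← h, vecMul_eq_sum, map_sum]
    exact Finset.sum_congr rfl fun k _ => (map_smul _ _ _).symm
  have hKi : toRatVec (K.row i) ∈ S := by
    rw [← Finset.add_sum_erase _ _ (Finset.mem_univ i), ← eq_sub_iff_add_eq] at hsum
    rw [← S.smul_mem_iff (RatFunc.algebraMap_ne_zero hi), algebraMap_smul, hsum]
    refine S.sub_mem (S.smul_of_tower_mem d (hmem i)) (S.sum_mem fun k hk => ?_)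
    rw [← hYk (Finset.ne_of_mem_erase hk)]
    exact S.smul_of_tower_mem (p k) (hmem k)
  have hYbasis : IsPolynomialBasis _ Y := hK.1.of_le_span <| Submodule.span_le.2 <| by
    rintro _ ⟨k, rfl⟩
    rcases eq_or_ne k i with rfl | hk
    · exact hKi
    · exact (congrArg (toRatVec · ∈ S) (hYk hk)).mp (hmem k)
  have hlt : rowDegree Y i < rowDegree K i := by
    obtain ⟨j, hj⟩ : ∃ j, s j ≠ 0 := by
      by_contra! hs0
      exact hYbasis.1.ne_zero i (funext fun j => by simp [toRat, Y, hs0])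
    have hpos : 0 < rowDegree K i := by
      exact_mod_cast (zero_le_degree_iff.2 hj).trans_lt (hs j)
    rw [← Nat.le_sub_one_iff_lt hpos, rowDegree_le_iff, Nat.sub_add_cancel hpos]
    exact fun j => (congrArg degree (congrFun hYi j)).trans_lt (hs j)
  refine (hK.2 Y hYbasis).not_gt (Finset.sum_lt_sum (fun k _ => ?_) ⟨i, Finset.mem_univ i, hlt⟩)
  rcases eq_or_ne k i with rfl | hk
  · exact hlt.le
  · exact (congrArg (fun v => Finset.univ.sup fun j => (v j).natDegree) (hYk hk)).le

lemma IsMinimalBasis.exists_natDegree_add_rowDegree_le [Fintype κ] [Fintype ι]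
    {K : Matrix κ ι F[X]} (hK : IsMinimalBasis K) {p : κ → F[X]} {d : F[X]} (hd : d ≠ 0)
    {s : ι → F[X]} (h : p ᵥ* K = d • s) {i : κ} (hi : p i ≠ 0) :
    ∃ j, ((d.natDegree + rowDegree K i : ℕ) : WithBot ℕ) ≤ ((p ᵥ* K) j).degree := by
  obtain ⟨j, hj⟩ := hK.exists_rowDegree_le_degree h hi
  refine ⟨j, ?_⟩
  rw [h, Pi.smul_apply, smul_eq_mul, degree_mul, degree_eq_natDegree hd, Nat.cast_add]
  gcongr

lemma IsMinimalBasis.dvd_of_vecMul_eq_smul [Fintype κ] [Fintype ι] {K : Matrix κ ι F[X]}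
    (hK : IsMinimalBasis K) {p : κ → F[X]} {d : F[X]} (hd : d ≠ 0) {s : ι → F[X]}
    (h : p ᵥ* K = d • s) (i : κ) : d ∣ p i := by
  classical
  by_contra hi
  set q : κ → F[X] := fun k => p k / d
  set r : κ → F[X] := fun k => p k % d
  have hrK : r ᵥ* K = d • (s - q ᵥ* K) := by
    have hp : p = d • q + r := funext fun k => (EuclideanDomain.div_add_mod _ _).symm
    rw [smul_sub, ← h, hp, add_vecMul, smul_vecMul, add_sub_cancel_left]
  obtain ⟨m, hm, hmax⟩ := Finset.exists_max_image (Finset.univ.filter (r · ≠ 0))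
    (fun k => (r k).natDegree + rowDegree K k)
    ⟨i, by simpa [r, EuclideanDomain.mod_eq_zero] using hi⟩
  simp only [Finset.mem_filter, Finset.mem_univ, true_and] at hm hmax
  have hrm : (r m).natDegree < d.natDegree :=
    natDegree_lt_natDegree hm (EuclideanDomain.mod_lt _ hd)
  obtain ⟨j, hj⟩ := hK.exists_natDegree_add_rowDegree_le hd hrK hm
  refine hj.not_gt (degree_vecMul_lt_of_natDegree_add_lt (natDegree_le_rowDegree K · j) ?_)
  exact fun k hk => (hmax k hk).trans_lt (Nat.add_lt_add_right hrm _)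

/-- The predictable degree property. -/
lemma IsMinimalBasis.natDegree_add_rowDegree_lt [Fintype κ] [Fintype ι] {K : Matrix κ ι F[X]}
    (hK : IsMinimalBasis K) {p : κ → F[X]} {d : ℕ} (h : ∀ j, ((p ᵥ* K) j).degree < d) {i : κ}
    (hi : p i ≠ 0) : (p i).natDegree + rowDegree K i < d := by
  classical
  by_contra! hd
  obtain ⟨m, hm, hmax⟩ := Finset.exists_max_image (Finset.univ.filter (p · ≠ 0))
    (fun k => toLex ((p k).natDegree + rowDegree K k, rowDegree K k)) ⟨i, by simpa using hi⟩
  simp only [Finset.mem_filter, Finset.mem_univ, true_and, Prod.Lex.toLex_le_toLex] at hm hmax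
  set n := (p m).natDegree
  have hX : (X ^ n : F[X]).Monic := monic_X_pow n
  set q : κ → F[X] := fun k => p k /ₘ X ^ n
  set r : κ → F[X] := fun k => p k %ₘ X ^ n
  have hp : p - r = (X ^ n : F[X]) • q := by
    ext1 k
    rw [Pi.sub_apply, Pi.smul_apply, smul_eq_mul, sub_eq_iff_eq_add', modByMonic_add_div]
  have hqm : q m ≠ 0 := by
    rw [Ne, divByMonic_eq_zero_iff hX, degree_X_pow, degree_eq_natDegree hm]
    exact lt_irrefl _
  obtain ⟨j, hj⟩ := hK.exists_natDegree_add_rowDegree_le hX.ne_zero (i := m)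
    (show (p - r) ᵥ* K = X ^ n • (q ᵥ* K) by rw [hp, smul_vecMul])
    (by rw [hp]; exact mul_ne_zero hX.ne_zero hqm)
  have hrK : ((r ᵥ* K) j).degree < (n + rowDegree K m : ℕ) := by
    refine degree_vecMul_lt_of_natDegree_add_lt (natDegree_le_rowDegree K · j) fun k hk => ?_
    have hrn : (r k).natDegree < n := by
      simpa only [natDegree_lt_iff_degree_lt hk, degree_X_pow] using degree_modByMonic_lt (p k) hX
    have hrp : (r k).natDegree ≤ (p k).natDegree := natDegree_modByMonic_le_left
    have := hmax k fun h0 => hk (by simp only [r, h0, zero_modByMonic])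
    lia
  have hpK : ((p ᵥ* K) j).degree < (n + rowDegree K m : ℕ) := by
    refine (h j).trans_le (Nat.cast_le.2 (hd.trans ?_))
    exact (hmax i hi).elim le_of_lt fun hi => hi.1.le
  rw [natDegree_X_pow, sub_vecMul] at hj
  exact hj.not_gt (mem_degreeLT.1 (sub_mem (mem_degreeLT.2 hpK) (mem_degreeLT.2 hrK)))

/-- If `v G` is polynomial then so is `v`, and if its `j`-th entry has degree less than `d + g j`
for all `j`, then `v` has degree less than `d`. For `g j` a bound on the degree of column `j` this
says that `G` has full row rank at all points of an algebraic closure and at infinity. -/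
def ReflectsDegree [Fintype α] (G : Matrix α β F[X]) (g : β → ℕ) : Prop :=
  ∀ (v : α → RatFunc F) (q : β → F[X]), v ᵥ* toRat G = toRatVec q →
    ∃ p : α → F[X], toRatVec p = v ∧
      ∀ d : ℕ, (∀ j, (q j).degree < (d + g j : ℕ)) → ∀ i, (p i).degree < d

lemma ReflectsDegree.of_polynomial [Fintype α] {G : Matrix α β F[X]} {g : β → ℕ}
    (hdvd : ∀ (p : α → F[X]) (d : F[X]) (s : β → F[X]), d ≠ 0 → p ᵥ* G = d • s → ∀ i, d ∣ p i)
    (hdeg : ∀ (p : α → F[X]) (d : ℕ), (∀ j, ((p ᵥ* G) j).degree < (d + g j : ℕ)) →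
      ∀ i, (p i).degree < d) :
    ReflectsDegree G g := by
  intro v q h
  obtain ⟨⟨d, hd⟩, hdv⟩ :=
    IsLocalization.exist_integer_multiples_of_finite (nonZeroDivisors F[X]) v
  choose r hr using hdv
  have hd0 : d ≠ 0 := nonZeroDivisors.ne_zero hd
  have hrv : toRatVec r = d • v := funext hr
  have hrG : r ᵥ* G = d • q := toRatVec_injective <| by
    rw [toRatVec_vecMul, hrv, smul_vecMul, h, map_smul]
  choose p hp using hdvd r d q hd0 hrG
  have hpv : toRatVec p = v := by
    ext1 i
    refine smul_right_injective (RatFunc F) hd0 ?_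
    calc d • toRatVec p i = toRatVec (d • p) i := by rw [map_smul, Pi.smul_apply]
      _ = toRatVec r i := congrArg (toRatVec · i) (funext hp).symm
      _ = d • v i := congrFun hrv i
  refine ⟨p, hpv, fun e he => hdeg p e ?_⟩
  have hpG : p ᵥ* G = q := toRatVec_injective <| by rw [toRatVec_vecMul, hpv, h]
  rwa [hpG]

lemma IsMinimalBasis.reflectsDegree [Fintype κ] [Fintype ι] {K : Matrix κ ι F[X]}
    (hK : IsMinimalBasis K) {ℓ : ℕ} (hℓ : ∀ i, ℓ ≤ rowDegree K i) :
    ReflectsDegree K fun _ => ℓ := by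
  refine .of_polynomial (fun p d s hd h => hK.dvd_of_vecMul_eq_smul hd h) fun p d h i => ?_
  by_cases hi : p i = 0
  · rw [hi, degree_zero]
    exact WithBot.bot_lt_coe d
  · rw [← natDegree_lt_iff_degree_lt hi]
    have := hK.natDegree_add_rowDegree_lt h hi
    have := hℓ i
    lia

lemma mem_leftNullspace [Fintype α] {G : Matrix α β (RatFunc F)} {v : α → RatFunc F} :
    v ∈ leftNullspace G ↔ v ᵥ* G = 0 :=
  LinearMap.mem_ker

/-- Both sides have dimension `|κ| = |ι| - |ν|`. -/
lemma IsDualMinimalBasis.range_vecMulLinear [Fintype κ] [Fintype ν] [Fintype ι]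
    {K : Matrix κ ι F[X]} {N : Matrix ν ι F[X]} (h : IsDualMinimalBasis K N) :
    LinearMap.range (toRat K).vecMulLinear = leftNullspace (toRat Nᵀ) := by
  refine Submodule.eq_of_le_of_finrank_eq ?_ ?_
  · rintro _ ⟨y, rfl⟩
    rw [mem_leftNullspace, vecMulLinear_apply, vecMul_vecMul, ← toRat_mul, h.mul_transpose,
      toRat_zero, vecMul_zero]
  · have hNt : (toRat Nᵀ).vecMulLinear = (toRat N).mulVecLin :=
      LinearMap.ext fun x => vecMul_transpose (toRat N) x
    have hN : Module.finrank (RatFunc F) (LinearMap.range (toRat Nᵀ).vecMulLinear) =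
        Fintype.card ν := by
      rw [← h.minimal_right.1.1.rank_matrix, Matrix.rank, hNt]
    have hsum := LinearMap.finrank_range_add_finrank_ker (toRat Nᵀ).vecMulLinear
    rw [hN, Module.finrank_fintype_fun_eq_card, ← h.card_add_card] at hsum
    rw [LinearMap.finrank_range_of_inj (vecMul_injective_iff.2 h.minimal_left.1.1),
      Module.finrank_fintype_fun_eq_card, leftNullspace]
    lia

/-! ### Polynomial matrices of full row rank at every point -/

lemma linearIndependent_row_of_rank_eq_card [Fintype α] [Fintype β] {K : Type*} [Field K]
    {G : Matrix α β K} (h : G.rank = Fintype.card α) : LinearIndependent K G.row := by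
  rw [linearIndependent_iff_card_eq_finrank_span, ← h]
  exact G.rank_eq_finrank_span_row

/-- A prime factor of `d` has a root in `E`, at which `p` vanishes. -/
lemma dvd_of_vecMul_eq_smul {E : Type*} [Field E] [Algebra F E] [IsAlgClosed E] [Fintype α]
    {G : Matrix α β F[X]} (hG : ∀ x : E, LinearIndependent E (G.map (aeval x)).row)
    {p : α → F[X]} {d : F[X]} {s : β → F[X]} (hd : d ≠ 0) (h : p ᵥ* G = d • s) (i : α) :
    d ∣ p i := by
  induction d using UniqueFactorizationMonoid.induction_on_prime generalizing p with
  | h₁ => exact absurd rfl hd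
  | h₂ d hu => exact hu.dvd
  | h₃ d π hd0 hπ ih =>
    obtain ⟨x, hx⟩ := IsAlgClosed.exists_aeval_eq_zero E π hπ.irreducible.degree_pos.ne'
    have hpx : (fun k => aeval x (p k)) = 0 := by
      refine ((vecMul_injective_iff.2 (hG x)).eq_iff' (zero_vecMul _)).1 (funext fun j => ?_)
      calc _ = aeval x ((p ᵥ* G) j) := ((aeval x : F[X] →ₐ[F] E).toRingHom.map_vecMul G p j).symm
        _ = 0 := by rw [h, Pi.smul_apply, smul_eq_mul, map_mul, map_mul, hx, zero_mul, zero_mul]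
    have hπp (k : α) : π ∣ p k := (hπ.irreducible.dvd_iff_aeval_eq_zero hx).1 (congrFun hpx k)
    choose r hr using hπp
    have hrG : r ᵥ* G = d • s := by
      refine smul_right_injective _ hπ.ne_zero ?_
      simp only [← smul_vecMul, smul_smul, ← h]
      exact congrArg (· ᵥ* G) (funext hr).symm
    rw [hr]
    exact mul_dvd_mul_left π (ih hd0 hrG)

/-- Otherwise the coefficients of the largest degree in `p` would be annihilated by the
coefficient matrix at infinity. -/
lemma degree_lt_of_linearIndependent_coeff [Fintype α] {G : Matrix α β F[X]} {g : β → ℕ}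
    (hdeg : ∀ i j, (G i j).natDegree ≤ g j)
    (hG : LinearIndependent F (of fun i j => (G i j).coeff (g j)).row) {p : α → F[X]} {d : ℕ}
    (h : ∀ j, ((p ᵥ* G) j).degree < (d + g j : ℕ)) (i : α) : (p i).degree < d := by
  obtain ⟨k, -, hk⟩ := Finset.exists_max_image Finset.univ (fun k => (p k).degree)
    ⟨i, Finset.mem_univ i⟩
  refine (hk i (Finset.mem_univ i)).trans_lt ?_
  by_contra! hd
  have hpk : p k ≠ 0 := zero_le_degree_iff.1 ((Nat.cast_nonneg d).trans hd)
  set e := (p k).natDegree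
  have hpe (l : α) : (p l).natDegree ≤ e := natDegree_le_natDegree (hk l (Finset.mem_univ l))
  have hde : d ≤ e := Nat.cast_le.1 (hd.trans degree_le_natDegree)
  have hcoeff : (fun l => (p l).coeff e) = 0 := by
    refine ((vecMul_injective_iff.2 hG).eq_iff' (zero_vecMul _)).1 (funext fun j => ?_)
    calc ∑ l, (p l).coeff e * (G l j).coeff (g j) = ((p ᵥ* G) j).coeff (e + g j) := by
          rw [vecMul, dotProduct, finsetSum_coeff]
          exact Finset.sum_congr rfl fun l _ =>
            (coeff_mul_add_eq_of_natDegree_le (hpe l) (hdeg l j)).symm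
      _ = 0 := coeff_eq_zero_of_degree_lt ((h j).trans_le (by gcongr))
  exact hpk (leadingCoeff_eq_zero.1 (congrFun hcoeff k))

lemma evalAt_zero_rev (a : ℕ) (G : Matrix α β F[X]) :
    evalAt 0 (rev a G) = of fun i j => (G i j).coeff a := by
  ext i j
  simp only [evalAt, rev, map_apply, of_apply, ← coeff_zero_eq_eval_zero, coeff_reflect,
    revAt_zero]

lemma reflectsDegree_fromCols {E : Type*} [Field E] [Algebra F E] [IsAlgClosed E] [Fintype α]
    [Fintype β] [Fintype γ] {A : Matrix α β F[X]} {B : Matrix α γ F[X]} {a b : ℕ}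
    (hAdeg : ∀ i j, (A i j).natDegree ≤ a) (hBdeg : ∀ i j, (B i j).natDegree ≤ b)
    (hfin : ∀ x : E, (fromCols (A.map (aeval x)) (B.map (aeval x))).rank = Fintype.card α)
    (hinf : (fromCols (evalAt 0 (rev a A)) (evalAt 0 (rev b B))).rank = Fintype.card α) :
    ReflectsDegree (fromCols A B) (Sum.elim (fun _ => a) fun _ => b) := by
  refine .of_polynomial (fun p d s hd h => dvd_of_vecMul_eq_smul (E := E) (fun x => ?_) hd h)
    fun p d h => degree_lt_of_linearIndependent_coeff ?_ ?_ h
  · rw [fromCols_map]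
    exact linearIndependent_row_of_rank_eq_card (hfin x)
  · rintro i (j | j)
    exacts [hAdeg i j, hBdeg i j]
  · convert linearIndependent_row_of_rank_eq_card hinf using 2
    ext i (j | j) <;> simp only [evalAt_zero_rev] <;> rfl

/-! ### Degree-preserving selections of coordinates -/

/-- Selecting the coordinates `f` maps the rational space `V` isomorphically onto `W`, and a vector
of `V` whose selected coordinates are polynomials is polynomial, of no larger degree. Injectivity on
`V` is the case `d = 0`. -/
structure IsDegreePreserving (V : Submodule (RatFunc F) (α → RatFunc F))
    (W : Submodule (RatFunc F) (β → RatFunc F)) (f : β → α) : Prop where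
  map_eq : V.map (LinearMap.funLeft (RatFunc F) (RatFunc F) f) = W
  exists_toRatVec : ∀ v ∈ V, ∀ q : β → F[X], v ∘ f = toRatVec q →
    ∃ p : α → F[X], toRatVec p = v ∧ ∀ d : ℕ, (∀ j, (q j).degree < d) → ∀ i, (p i).degree < d

namespace IsDegreePreserving

variable {U : Submodule (RatFunc F) (γ → RatFunc F)} {V : Submodule (RatFunc F) (α → RatFunc F)}
  {W : Submodule (RatFunc F) (β → RatFunc F)} {f : β → α} {g : γ → β}

lemma eq_zero (h : IsDegreePreserving V W f) {v : α → RatFunc F} (hv : v ∈ V) (hvf : v ∘ f = 0) :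
    v = 0 := by
  obtain ⟨p, rfl, hp⟩ := h.exists_toRatVec v hv 0 (hvf.trans (map_zero _).symm)
  have hp0 : p = 0 := funext fun i => degree_eq_bot.1 <|
    Nat.WithBot.lt_zero_iff.1 <| hp 0 (fun _ => WithBot.bot_lt_coe 0) i
  rw [hp0, map_zero]

lemma injOn (h : IsDegreePreserving V W f) :
    Set.InjOn (LinearMap.funLeft (RatFunc F) (RatFunc F) f) V :=
  LinearMap.injOn_of_disjoint_ker le_rfl <| LinearMap.disjoint_ker.2 fun _ => h.eq_zero

lemma eq_bot (h : IsDegreePreserving V ⊥ f) : V = ⊥ :=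
  (Submodule.eq_bot_iff V).2 fun _ hv =>
    h.eq_zero hv <| (Submodule.mem_bot _).1 (h.map_eq ▸ Submodule.mem_map_of_mem hv)

lemma comp (hf : IsDegreePreserving V W f) (hg : IsDegreePreserving W U g) :
    IsDegreePreserving V U (f ∘ g) where
  map_eq := by
    rw [LinearMap.funLeft_comp, Submodule.map_comp, hf.map_eq, hg.map_eq]
  exists_toRatVec v hv q hq := by
    obtain ⟨r, hr, hrq⟩ := hg.exists_toRatVec (v ∘ f) (hf.map_eq ▸ ⟨v, hv, rfl⟩) q hq
    obtain ⟨p, hp, hpr⟩ := hf.exists_toRatVec v hv r hr.symm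
    exact ⟨p, hp, fun d hd => hpr d (hrq d hd)⟩

lemma of_comp (h : IsDegreePreserving V U (f ∘ g))
    (hV : V.map (LinearMap.funLeft (RatFunc F) (RatFunc F) f) = W) :
    IsDegreePreserving V W f where
  map_eq := hV
  exists_toRatVec v hv q hq := by
    obtain ⟨p, hp, hpq⟩ := h.exists_toRatVec v hv (q ∘ g) (congrArg (· ∘ g) hq)
    exact ⟨p, hp, fun d hd => hpq d fun j => hd (g j)⟩

lemma isPolynomialBasis_submatrix (h : IsDegreePreserving V W f) {Z : Matrix κ α F[X]}
    (hZ : IsPolynomialBasis V Z) : IsPolynomialBasis W (Z.submatrix id f) := by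
  constructor
  · refine hZ.1.map_injOn (LinearMap.funLeft (RatFunc F) (RatFunc F) f) ?_
    rw [hZ.2]
    exact h.injOn
  · rw [← h.map_eq, ← hZ.2, Submodule.map_span, ← Set.range_comp]
    rfl

lemma exists_isPolynomialBasis (h : IsDegreePreserving V W f) {Y : Matrix κ β F[X]}
    (hY : IsPolynomialBasis W Y) :
    ∃ Z : Matrix κ α F[X], IsPolynomialBasis V Z ∧ Z.submatrix id f = Y := by
  have hlift (i : κ) : ∃ p : α → F[X], toRatVec p ∈ V ∧ p ∘ f = Y.row i := by
    have hi : (toRat Y).row i ∈ W := hY.2 ▸ Submodule.subset_span ⟨i, rfl⟩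
    rw [← h.map_eq] at hi
    obtain ⟨v, hv, hvi⟩ := hi
    obtain ⟨p, rfl, -⟩ := h.exists_toRatVec v hv (Y.row i) hvi
    exact ⟨p, hv, toRatVec_injective hvi⟩
  choose Z hZV hZY using hlift
  have hrow : LinearMap.funLeft (RatFunc F) (RatFunc F) f ∘ (toRat (of Z)).row = (toRat Y).row :=
    funext fun i => congrArg toRatVec (hZY i)
  have hle : Submodule.span (RatFunc F) (Set.range (toRat (of Z)).row) ≤ V :=
    Submodule.span_le.2 (Set.range_subset_iff.2 hZV)
  refine ⟨of Z, ⟨.of_comp (LinearMap.funLeft (RatFunc F) (RatFunc F) f) ?_, ?_⟩, funext hZY⟩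
  · rw [hrow]
    exact hY.1
  · refine SetLike.coe_injective ((h.injOn.image_eq_image_iff hle le_rfl).1 ?_)
    rw [← Submodule.map_coe, ← Submodule.map_coe, Submodule.map_span, ← Set.range_comp, hrow,
      hY.2, h.map_eq]

variable [Fintype α] [Fintype β]

lemma rowDegree_submatrix (h : IsDegreePreserving V W f) {Z : Matrix κ α F[X]}
    (hZ : IsPolynomialBasis V Z) (i : κ) : rowDegree (Z.submatrix id f) i = rowDegree Z i := by
  refine le_antisymm (Finset.sup_le fun j _ => natDegree_le_rowDegree Z i (f j)) ?_
  obtain ⟨p, hp, hdeg⟩ := h.exists_toRatVec (toRatVec (Z.row i))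
    (hZ.2 ▸ Submodule.subset_span ⟨i, rfl⟩) ((Z.submatrix id f).row i) rfl
  obtain rfl := toRatVec_injective hp
  exact rowDegree_le_iff.2 (hdeg _ (rowDegree_le_iff.1 le_rfl))

variable [Fintype κ]

lemma isMinimalBasisOf_submatrix (h : IsDegreePreserving V W f) {Z : Matrix κ α F[X]}
    (hZ : IsMinimalBasisOf V Z) : IsMinimalBasisOf W (Z.submatrix id f) := by
  refine ⟨h.isPolynomialBasis_submatrix hZ.1, fun Y hY => ?_⟩
  obtain ⟨X, hX, rfl⟩ := h.exists_isPolynomialBasis hY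
  simpa only [h.rowDegree_submatrix hZ.1, h.rowDegree_submatrix hX] using hZ.2 X hX

lemma exists_isMinimalBasisOf (h : IsDegreePreserving V W f) {Y : Matrix κ β F[X]}
    (hY : IsMinimalBasisOf W Y) :
    ∃ Z : Matrix κ α F[X], IsMinimalBasisOf V Z ∧ Z.submatrix id f = Y := by
  obtain ⟨Z, hZ, rfl⟩ := h.exists_isPolynomialBasis hY.1
  refine ⟨Z, ⟨hZ, fun X hX => ?_⟩, rfl⟩
  simpa only [h.rowDegree_submatrix hZ, h.rowDegree_submatrix hX] using
    hY.2 _ (h.isPolynomialBasis_submatrix hX)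

lemma isMinimalIndices_iff (h : IsDegreePreserving V W f) {t : ℕ} (η : Fin t → ℕ) :
    IsMinimalIndices V η ↔ IsMinimalIndices W η := by
  refine and_congr_right fun _ => and_congr ⟨?_, ?_⟩ ⟨?_, ?_⟩
  · rintro ⟨Z, hZ⟩
    exact ⟨_, h.isMinimalBasisOf_submatrix hZ⟩
  · rintro ⟨Y, hY⟩
    obtain ⟨Z, hZ, -⟩ := h.exists_isMinimalBasisOf hY
    exact ⟨Z, hZ⟩
  · intro hV Y hY
    obtain ⟨Z, hZ, rfl⟩ := h.exists_isMinimalBasisOf hY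
    simpa only [h.rowDegree_submatrix hZ.1] using hV Z hZ
  · intro hW Z hZ
    simpa only [h.rowDegree_submatrix hZ.1] using hW _ (h.isMinimalBasisOf_submatrix hZ)

end IsDegreePreserving

lemma ReflectsDegree.isDegreePreserving [Fintype α] [Fintype κ] {G : Matrix κ β F[X]}
    {g : β → ℕ} (hG : ReflectsDegree G g) {H : Matrix α β F[X]}
    (hH : ∀ i j, (H i j).natDegree ≤ g j) {W : Submodule (RatFunc F) (α → RatFunc F)}
    (hW : (leftNullspace (toRat (fromRows G H))).map
      (LinearMap.funLeft (RatFunc F) (RatFunc F) Sum.inr) = W) :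
    IsDegreePreserving (leftNullspace (toRat (fromRows G H))) W Sum.inr where
  map_eq := hW
  exists_toRatVec v hv q hq := by
    rw [mem_leftNullspace, toRat_fromRows, vecMul_fromRows, hq, ← toRatVec_vecMul,
      add_eq_zero_iff_eq_neg, ← map_neg] at hv
    obtain ⟨p, hp, hdeg⟩ := hG _ _ hv
    refine ⟨Sum.elim p q, funext ?_, fun d hd => Sum.rec (hdeg d fun j => ?_) hd⟩
    · exact Sum.rec (congrFun hp) (congrFun hq.symm)
    · rw [Pi.neg_apply, degree_neg]
      exact degree_vecMul_lt hd fun i => hH i j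

lemma isDegreePreserving_submatrix_equiv [Fintype α] [Fintype γ] (e : α ≃ γ)
    (G : Matrix γ β F[X]) :
    IsDegreePreserving (leftNullspace (toRat (G.submatrix e id))) (leftNullspace (toRat G))
      e.symm := by
  have hmem (v : α → RatFunc F) :
      v ∈ leftNullspace (toRat (G.submatrix e id)) ↔ v ∘ e.symm ∈ leftNullspace (toRat G) := by
    rw [mem_leftNullspace, mem_leftNullspace]
    exact Eq.congr_left (submatrix_vecMul_equiv (toRat G) v e id)
  refine ⟨Submodule.ext fun w => ⟨?_, fun hw => ?_⟩, fun v _ q hq => ?_⟩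
  · rintro ⟨v, hv, rfl⟩
    exact (hmem v).1 hv
  · have hwe : (w ∘ e) ∘ e.symm = w := funext fun k => congrArg w (e.apply_symm_apply k)
    exact ⟨w ∘ e, (hmem _).2 (hwe.symm ▸ hw), hwe⟩
  · refine ⟨q ∘ e, funext fun i => ?_, fun d hd i => hd (e i)⟩
    exact (congrFun hq (e i)).symm.trans (congrArg v (e.symm_apply_apply i))

/-! ### Polynomial system matrices -/

lemma leftNullspace_toRat_eq_bot_iff [Fintype ν] [DecidableEq ν] {A : Matrix ν ν F[X]} :
    leftNullspace (toRat A) = ⊥ ↔ A.det ≠ 0 := by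
  rw [← det_toRat_ne_zero_iff, ← isUnit_iff_ne_zero, ← isUnit_iff_isUnit_det,
    ← vecMul_injective_iff_isUnit]
  exact LinearMap.ker_eq_bot

section SystemMatrix

variable [Fintype α] [Fintype ν] {A : Matrix ν ν F[X]} {B : Matrix ν β F[X]} {C : Matrix α ν F[X]}
  {D : Matrix α β F[X]}

lemma mem_leftNullspace_systemMatrix {z : ν ⊕ α → RatFunc F} :
    z ∈ leftNullspace (toRat (systemMatrix A B C D)) ↔
      (z ∘ Sum.inl) ᵥ* toRat A = (z ∘ Sum.inr) ᵥ* toRat C ∧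
      (z ∘ Sum.inl) ᵥ* toRat B + (z ∘ Sum.inr) ᵥ* toRat D = 0 := by
  have hC : toRat (-C) = -toRat C := Matrix.map_neg _ (map_neg _) C
  rw [mem_leftNullspace, systemMatrix, toRat_fromBlocks, hC, vecMul_fromBlocks, vecMul_neg,
    ← sub_eq_add_neg, ← sub_eq_zero (b := (z ∘ Sum.inr) ᵥ* toRat C), ← Sum.elim_zero_zero,
    Sum.elim_eq_iff]

lemma mem_leftNullspace_transferFunction [DecidableEq ν] {x : α → RatFunc F} :
    x ∈ leftNullspace (transferFunction A B C D) ↔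
      (x ᵥ* toRat C ᵥ* (toRat A)⁻¹) ᵥ* toRat B + x ᵥ* toRat D = 0 := by
  rw [mem_leftNullspace, transferFunction, vecMul_add, ← vecMul_vecMul, ← vecMul_vecMul, add_comm]

lemma mem_leftNullspace_systemMatrix_iff_transferFunction [DecidableEq ν] (hA : A.det ≠ 0)
    {z : ν ⊕ α → RatFunc F} :
    z ∈ leftNullspace (toRat (systemMatrix A B C D)) ↔
      z ∘ Sum.inl = (z ∘ Sum.inr) ᵥ* toRat C ᵥ* (toRat A)⁻¹ ∧
        z ∘ Sum.inr ∈ leftNullspace (transferFunction A B C D) := by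
  have hU : IsUnit (toRat A).det := isUnit_iff_ne_zero.2 (det_toRat_ne_zero_iff.2 hA)
  have hsolve : (z ∘ Sum.inl) ᵥ* toRat A = (z ∘ Sum.inr) ᵥ* toRat C ↔
      z ∘ Sum.inl = (z ∘ Sum.inr) ᵥ* toRat C ᵥ* (toRat A)⁻¹ := by
    constructor <;> intro h
    · rw [← h, vecMul_vecMul, mul_nonsing_inv _ hU, vecMul_one]
    · rw [h, vecMul_vecMul _ (toRat A)⁻¹, nonsing_inv_mul _ hU, vecMul_one]
  rw [mem_leftNullspace_systemMatrix, mem_leftNullspace_transferFunction, hsolve]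
  exact and_congr_right fun h => by rw [h]

lemma map_leftNullspace_systemMatrix [DecidableEq ν] (hA : A.det ≠ 0) :
    (leftNullspace (toRat (systemMatrix A B C D))).map
      (LinearMap.funLeft (RatFunc F) (RatFunc F) Sum.inr) =
        leftNullspace (transferFunction A B C D) := by
  ext x
  constructor
  · rintro ⟨z, hz, rfl⟩
    exact ((mem_leftNullspace_systemMatrix_iff_transferFunction hA).1 hz).2
  · intro hx
    exact ⟨Sum.elim (x ᵥ* toRat C ᵥ* (toRat A)⁻¹) x,
      (mem_leftNullspace_systemMatrix_iff_transferFunction hA).2 ⟨rfl, hx⟩, rfl⟩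

lemma isDegreePreserving_systemMatrix [DecidableEq ν] (hA : A.det ≠ 0) {a b : ℕ}
    (hAB : ReflectsDegree (fromCols A B) (Sum.elim (fun _ => a) fun _ => b))
    (hC : ∀ i j, (C i j).natDegree ≤ a) (hD : ∀ i j, (D i j).natDegree ≤ b) :
    IsDegreePreserving (leftNullspace (toRat (systemMatrix A B C D)))
      (leftNullspace (transferFunction A B C D)) Sum.inr := by
  have hmap := map_leftNullspace_systemMatrix (B := B) (C := C) (D := D) hA
  rw [systemMatrix, ← fromRows_fromCols_eq_fromBlocks] at hmap ⊢
  refine hAB.isDegreePreserving (fun i => Sum.rec (fun j => ?_) (hD i)) hmap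
  exact (natDegree_neg (C i j)).trans_le (hC i j)

end SystemMatrix

/-! ### Block minimal bases -/

lemma map_leftNullspace_fromRows [Fintype α] [Fintype κ] [Fintype ι] {M : Matrix α ι F[X]}
    {K : Matrix κ ι F[X]} {N : Matrix ν ι F[X]}
    (hKN : LinearMap.range (toRat K).vecMulLinear = leftNullspace (toRat Nᵀ)) :
    (leftNullspace (toRat (fromRows M K))).map
      (LinearMap.funLeft (RatFunc F) (RatFunc F) Sum.inl) = leftNullspace (toRat (M * Nᵀ)) := by
  ext x
  have hx : x ∈ leftNullspace (toRat (M * Nᵀ)) ↔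
      x ᵥ* toRat M ∈ LinearMap.range (toRat K).vecMulLinear := by
    rw [hKN, mem_leftNullspace, mem_leftNullspace, toRat_mul, vecMul_vecMul]
  have hz (z : α ⊕ κ → RatFunc F) : z ∈ leftNullspace (toRat (fromRows M K)) ↔
      (z ∘ Sum.inl) ᵥ* toRat M = (-(z ∘ Sum.inr)) ᵥ* toRat K := by
    rw [mem_leftNullspace, toRat_fromRows, vecMul_fromRows, neg_vecMul, add_eq_zero_iff_eq_neg]
  rw [hx]
  constructor
  · rintro ⟨z, hzK, rfl⟩
    exact ⟨_, ((hz z).1 hzK).symm⟩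
  · rintro ⟨y, hy⟩
    refine ⟨Sum.elim x (-y), (hz _).2 ?_, rfl⟩
    rw [Sum.elim_comp_inl, Sum.elim_comp_inr, neg_neg]
    exact hy.symm

lemma isDegreePreserving_fromRows [Fintype α] [Fintype κ] [Fintype ι] {M : Matrix α ι F[X]}
    {K : Matrix κ ι F[X]} {N : Matrix ν ι F[X]} {g : ι → ℕ} (hK : ReflectsDegree K g)
    (hKN : LinearMap.range (toRat K).vecMulLinear = leftNullspace (toRat Nᵀ))
    (hM : ∀ i j, (M i j).natDegree ≤ g j) :
    IsDegreePreserving (leftNullspace (toRat (fromRows M K))) (leftNullspace (toRat (M * Nᵀ)))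
      Sum.inl := by
  have hcomm : fromRows M K = (fromRows K M).submatrix (Equiv.sumComm α κ) id := by
    ext (i | i) j <;> rfl
  have hswap := isDegreePreserving_submatrix_equiv (Equiv.sumComm α κ) (fromRows K M)
  have hmap := map_leftNullspace_fromRows (M := M) hKN
  rw [hcomm] at hmap ⊢
  refine hswap.comp (hK.isDegreePreserving hM ?_)
  rw [← hswap.map_eq, ← hmap, ← Submodule.map_comp]
  rfl

lemma det_fromRows_ne_zero [Fintype κ] [Fintype ν] [DecidableEq κ] [DecidableEq ν]
    {M N : Matrix ν (ν ⊕ κ) F[X]} {K : Matrix κ (ν ⊕ κ) F[X]} {g : ν ⊕ κ → ℕ}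
    (hMN : (M * Nᵀ).det ≠ 0) (hK : ReflectsDegree K g)
    (hKN : LinearMap.range (toRat K).vecMulLinear = leftNullspace (toRat Nᵀ))
    (hM : ∀ i j, (M i j).natDegree ≤ g j) : (fromRows M K).det ≠ 0 := by
  have hsel := isDegreePreserving_fromRows hK hKN hM
  rw [leftNullspace_toRat_eq_bot_iff.2 hMN] at hsel
  exact leftNullspace_toRat_eq_bot_iff.1 hsel.eq_bot

section BlockDiagonal

variable {K : Matrix κ ι F[X]} {N : Matrix ν ι F[X]} {K' : Matrix κ' ι' F[X]}
  {N' : Matrix ν' ι' F[X]}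

lemma ReflectsDegree.fromBlocks_diagonal [Fintype κ] [Fintype κ'] {g : ι → ℕ} {g' : ι' → ℕ}
    (hK : ReflectsDegree K g) (hK' : ReflectsDegree K' g') :
    ReflectsDegree (fromBlocks K 0 0 K') (Sum.elim g g') := by
  intro v q h
  rw [toRat_fromBlocks, toRat_zero, toRat_zero, vecMul_fromBlocks, vecMul_zero, vecMul_zero,
    add_zero, zero_add] at h
  obtain ⟨p, hp, hdeg⟩ := hK (v ∘ Sum.inl) (q ∘ Sum.inl) (congrArg (· ∘ Sum.inl) h)
  obtain ⟨p', hp', hdeg'⟩ := hK' (v ∘ Sum.inr) (q ∘ Sum.inr) (congrArg (· ∘ Sum.inr) h)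
  exact ⟨Sum.elim p p', funext (Sum.rec (congrFun hp) (congrFun hp')),
    fun d hd => Sum.rec (hdeg d fun j => hd (.inl j)) (hdeg' d fun j => hd (.inr j))⟩

lemma range_vecMulLinear_fromBlocks_diagonal [Fintype κ] [Fintype κ'] [Fintype ι] [Fintype ι']
    (hKN : LinearMap.range (toRat K).vecMulLinear = leftNullspace (toRat Nᵀ))
    (hKN' : LinearMap.range (toRat K').vecMulLinear = leftNullspace (toRat N'ᵀ)) :
    LinearMap.range (toRat (fromBlocks K 0 0 K')).vecMulLinear =
      leftNullspace (toRat (fromBlocks N 0 0 N')ᵀ) := by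
  have hrange (v : ι ⊕ ι' → RatFunc F) :
      v ∈ LinearMap.range (toRat (fromBlocks K 0 0 K')).vecMulLinear ↔
        v ∘ Sum.inl ∈ LinearMap.range (toRat K).vecMulLinear ∧
          v ∘ Sum.inr ∈ LinearMap.range (toRat K').vecMulLinear := by
    simp only [LinearMap.mem_range, vecMulLinear_apply, toRat_fromBlocks, toRat_zero,
      vecMul_fromBlocks, vecMul_zero, add_zero, zero_add]
    constructor
    · rintro ⟨y, rfl⟩
      exact ⟨⟨_, rfl⟩, ⟨_, rfl⟩⟩
    · rintro ⟨⟨y, hy⟩, ⟨y', hy'⟩⟩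
      exact ⟨Sum.elim y y', funext (Sum.rec (congrFun hy) (congrFun hy'))⟩
  ext v
  rw [hrange, hKN, hKN', mem_leftNullspace, mem_leftNullspace, mem_leftNullspace,
    fromBlocks_transpose, transpose_zero, transpose_zero, toRat_fromBlocks, toRat_zero,
    toRat_zero, vecMul_fromBlocks, vecMul_zero, vecMul_zero, add_zero, zero_add,
    ← Sum.elim_zero_zero, Sum.elim_eq_iff]

end BlockDiagonal

/-- The system matrix with state matrix `[MA; KA]` whose transfer function linearizes that of the
system matrix with the blocks `MA NAᵀ`, `MB NDᵀ`, `MC NAᵀ` and `MD NDᵀ`. -/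
noncomputable abbrev blockSystemMatrix (MA : Matrix ν (ν ⊕ κ) F[X]) (KA : Matrix κ (ν ⊕ κ) F[X])
    (MB : Matrix ν ι F[X]) (MC : Matrix α (ν ⊕ κ) F[X]) (MD : Matrix α ι F[X])
    (KD : Matrix κ' ι F[X]) : Matrix ((ν ⊕ κ) ⊕ (α ⊕ κ')) ((ν ⊕ κ) ⊕ ι) F[X] :=
  systemMatrix (fromRows MA KA) (fromRows MB 0) (fromRows MC 0) (fromRows MD KD)

section BlockSystemMatrix

variable [Fintype α] [Fintype κ] [Fintype ν] [Fintype ι] [Fintype κ']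
  {MA : Matrix ν (ν ⊕ κ) F[X]} {KA : Matrix κ (ν ⊕ κ) F[X]} {MB : Matrix ν ι F[X]}
  {MC : Matrix α (ν ⊕ κ) F[X]} {MD : Matrix α ι F[X]} {KD : Matrix κ' ι F[X]}
  {NA : Matrix ν (ν ⊕ κ) F[X]} {ND : Matrix β ι F[X]} {a : ν ⊕ κ → ℕ} {b : ι → ℕ}

/-- Up to a permutation of its rows, the block system matrix is a block column with blocks
`[MA MB; -MC MD]` and `diag(KA, KD)`. -/
lemma isDegreePreserving_blockSystemMatrix
    (hMA : ∀ i j, (MA i j).natDegree ≤ a j) (hMB : ∀ i j, (MB i j).natDegree ≤ b j)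
    (hMC : ∀ i j, (MC i j).natDegree ≤ a j) (hMD : ∀ i j, (MD i j).natDegree ≤ b j)
    (hKA : ReflectsDegree KA a) (hKD : ReflectsDegree KD b)
    (hKNA : LinearMap.range (toRat KA).vecMulLinear = leftNullspace (toRat NAᵀ))
    (hKND : LinearMap.range (toRat KD).vecMulLinear = leftNullspace (toRat NDᵀ)) :
    IsDegreePreserving (leftNullspace (toRat (blockSystemMatrix MA KA MB MC MD KD)))
      (leftNullspace (toRat (systemMatrix (MA * NAᵀ) (MB * NDᵀ) (MC * NAᵀ) (MD * NDᵀ))))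
      (Sum.map Sum.inl Sum.inl) := by
  have hperm : blockSystemMatrix MA KA MB MC MD KD =
      (fromRows (fromBlocks MA MB (-MC) MD) (fromBlocks KA 0 0 KD)).submatrix
        (Equiv.sumSumSumComm ν κ α κ') id := by
    ext ((i | i) | (i | i)) (j | j) <;> simp [systemMatrix]
  have hmul : fromBlocks MA MB (-MC) MD * (fromBlocks NA 0 0 ND)ᵀ =
      systemMatrix (MA * NAᵀ) (MB * NDᵀ) (MC * NAᵀ) (MD * NDᵀ) := by
    simp [fromBlocks_transpose, fromBlocks_multiply, systemMatrix]
  have hdeg (i : ν ⊕ α) (j : (ν ⊕ κ) ⊕ ι) :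
      (fromBlocks MA MB (-MC) MD i j).natDegree ≤ Sum.elim a b j := by
    rcases i with i | i <;> rcases j with j | j
    exacts [hMA i j, hMB i j, (natDegree_neg _).trans_le (hMC i j), hMD i j]
  have hsel := isDegreePreserving_fromRows (hKA.fromBlocks_diagonal hKD)
    (range_vecMulLinear_fromBlocks_diagonal hKNA hKND) hdeg
  rw [hmul] at hsel
  rw [hperm]
  convert (isDegreePreserving_submatrix_equiv (Equiv.sumSumSumComm ν κ α κ') _).comp hsel using 1
  ext (i | i) <;> rfl

end BlockSystemMatrix

end RationalMatrix

open Matrix Polynomial in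
theorem mainTheorem4_general {F : Type*} [Field F] {E : Type*} [Field E] [Algebra F E]
    [IsAlgClosed E] {α β ν κ κ' ι : Type*} [Fintype α] [Fintype β] [Fintype ν] [DecidableEq ν]
    [Fintype κ] [DecidableEq κ] [Fintype κ'] [Fintype ι] {ℓ : ℕ}
    {A : Matrix ν ν F[X]} {B : Matrix ν β F[X]} {C : Matrix α ν F[X]} {D : Matrix α β F[X]}
    (hA : A.det ≠ 0)
    {MA : Matrix ν (ν ⊕ κ) F[X]} {KA : Matrix κ (ν ⊕ κ) F[X]} {NA : Matrix ν (ν ⊕ κ) F[X]}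
    {MB : Matrix ν ι F[X]} {MC : Matrix α (ν ⊕ κ) F[X]} {MD : Matrix α ι F[X]}
    {KD : Matrix κ' ι F[X]} {ND : Matrix β ι F[X]}
    (hMA : MA * NAᵀ = A) (hMB : MB * NDᵀ = B) (hMC : MC * NAᵀ = C) (hMD : MD * NDᵀ = D)
    (hMAdeg : ∀ i j, (MA i j).natDegree ≤ ℓ) (hMBdeg : ∀ i j, (MB i j).natDegree ≤ ℓ)
    (hMCdeg : ∀ i j, (MC i j).natDegree ≤ ℓ) (hMDdeg : ∀ i j, (MD i j).natDegree ≤ ℓ)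
    (hKAdeg : ∀ i, ℓ ≤ rowDegree KA i) (hKDdeg : ∀ i, ℓ ≤ rowDegree KD i)
    (hNA : IsDualMinimalBasis KA NA) (hND : IsDualMinimalBasis KD ND)
    (hfin : ∀ x : E, (fromCols (A.map (aeval x)) (B.map (aeval x))).rank = Fintype.card ν)
    (hinf : (fromCols (evalAt 0 (rev (matDegree NA + ℓ) A))
      (evalAt 0 (rev (matDegree ND + ℓ) B))).rank = Fintype.card ν) :
    (∀ (t : ℕ) (Z : Matrix (Fin t) ((ν ⊕ κ) ⊕ (α ⊕ κ')) F[X]),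
      IsLeftMinimalBasis (toRat (blockSystemMatrix MA KA MB MC MD KD)) Z →
        IsLeftMinimalBasis (transferFunction (fromRows MA KA) (fromRows MB 0) (fromRows MC 0)
          (fromRows MD KD)) Z.toCols₂ ∧
        IsLeftMinimalBasis (transferFunction A B C D) Z.toCols₂.toCols₁) ∧
    (∀ (t : ℕ) (η : Fin t → ℕ),
      (IsLeftMinimalIndices (toRat (blockSystemMatrix MA KA MB MC MD KD)) η ↔
        IsLeftMinimalIndices (transferFunction (fromRows MA KA) (fromRows MB 0) (fromRows MC 0)
          (fromRows MD KD)) η) ∧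
      (IsLeftMinimalIndices (toRat (blockSystemMatrix MA KA MB MC MD KD)) η ↔
        IsLeftMinimalIndices (transferFunction A B C D) η)) := by
  subst hMA hMB hMC hMD
  have hKA := hNA.minimal_left.reflectsDegree hKAdeg
  have hKD := hND.minimal_left.reflectsDegree hKDdeg
  have hAB := reflectsDegree_fromCols (natDegree_mul_transpose_le hMAdeg NA)
    (natDegree_mul_transpose_le hMBdeg ND) hfin hinf
  have hR : IsDegreePreserving _ _ (Sum.inr ∘ Sum.inl) :=
    (isDegreePreserving_blockSystemMatrix hMAdeg hMBdeg hMCdeg hMDdeg hKA hKD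
      hNA.range_vecMulLinear hND.range_vecMulLinear).comp
    (isDegreePreserving_systemMatrix hA hAB (natDegree_mul_transpose_le hMCdeg NA)
      (natDegree_mul_transpose_le hMDdeg ND))
  have hRhat := hR.of_comp <| map_leftNullspace_systemMatrix <|
    det_fromRows_ne_zero hA hKA hNA.range_vecMulLinear hMAdeg
  exact ⟨fun t Z hZ => ⟨hRhat.isMinimalBasisOf_submatrix hZ, hR.isMinimalBasisOf_submatrix hZ⟩,
    fun t η => ⟨hRhat.isMinimalIndices_iff η, hR.isMinimalIndices_iff η⟩⟩

theorem mainTheorem4 {F : Type*} [Field F] [IsAlgClosed F] {n m p kA kD : ℕ}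
    -- the rational matrix `R = D + C A⁻¹ B`
    (A : Matrix (Fin n) (Fin n) (Polynomial F)) (B : Matrix (Fin n) (Fin m) (Polynomial F))
    (C : Matrix (Fin p) (Fin n) (Polynomial F)) (D : Matrix (Fin p) (Fin m) (Polynomial F))
    (hA : A.det ≠ 0)
    (R : Matrix (Fin p) (Fin m) (RatFunc F)) (hR : R = transferFunction A B C D)
    -- the pencils `L_A = [M_A; K_A]` and `L_D = [M_D; K_D]`; their column index sets have
    -- `n + kA` and `m + kD` elements
    (MA : Matrix (Fin n) (Fin n ⊕ Fin kA) (Polynomial F))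
    (KA : Matrix (Fin kA) (Fin n ⊕ Fin kA) (Polynomial F))
    (MD : Matrix (Fin p) (Fin m ⊕ Fin kD) (Polynomial F))
    (KD : Matrix (Fin kD) (Fin m ⊕ Fin kD) (Polynomial F))
    (hLA : IsStrongBlockMinimalBasisPencil MA KA) (hLD : IsStrongBlockMinimalBasisPencil MD KD)
    -- dual minimal bases, through which `L_A` and `L_D` are associated with `A` and `D`
    (NA : Matrix (Fin n) (Fin n ⊕ Fin kA) (Polynomial F))
    (ND : Matrix (Fin m) (Fin m ⊕ Fin kD) (Polynomial F))
    (hNA : IsDualMinimalBasis KA NA) (hND : IsDualMinimalBasis KD ND)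
    (hMA : MA * NA.transpose = A) (hMD : MD * ND.transpose = D)
    -- the linear polynomial matrices `M_B` and `M_C`
    (MB : Matrix (Fin n) (Fin m ⊕ Fin kD) (Polynomial F))
    (MC : Matrix (Fin p) (Fin n ⊕ Fin kA) (Polynomial F))
    (hMBlin : IsPencil MB) (hMClin : IsPencil MC)
    (hMB : MB * ND.transpose = B) (hMC : MC * NA.transpose = C)
    -- the linear polynomial system matrix `𝓛` and its transfer function matrix
    (L : Matrix ((Fin n ⊕ Fin kA) ⊕ (Fin p ⊕ Fin kD)) ((Fin n ⊕ Fin kA) ⊕ (Fin m ⊕ Fin kD))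
      (Polynomial F))
    (hL : L = systemMatrix (Matrix.fromRows MA KA) (Matrix.fromRows MB 0)
      (Matrix.fromRows MC 0) (Matrix.fromRows MD KD))
    (Rhat : Matrix (Fin p ⊕ Fin kD) (Fin m ⊕ Fin kD) (RatFunc F))
    (hRhat : Rhat = transferFunction (Matrix.fromRows MA KA) (Matrix.fromRows MB 0)
      (Matrix.fromRows MC 0) (Matrix.fromRows MD KD))
    -- the two rank conditions
    (hfin : ∀ x : F, (Matrix.fromCols (evalAt x A) (evalAt x B)).rank = n)
    (hinf : (Matrix.fromCols (evalAt 0 (rev (matDegree NA + 1) A))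
      (evalAt 0 (rev (matDegree ND + 1) B))).rank = n) :
    -- (a) each row of `Z` is `[y x]` with `x = [u w]`, where `x` is conformable with the rows
    -- of `Rhat` and `u` with the rows of `R`
    (∀ (t : ℕ) (Z : Matrix (Fin t) ((Fin n ⊕ Fin kA) ⊕ (Fin p ⊕ Fin kD)) (Polynomial F)),
      IsLeftMinimalBasis (toRat L) Z →
        IsLeftMinimalBasis Rhat Z.toCols₂ ∧ IsLeftMinimalBasis R Z.toCols₂.toCols₁) ∧
    -- (b) the left minimal indices of `𝓛`, `Rhat` and `R` coincide
    (∀ (t : ℕ) (η : Fin t → ℕ),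
      (IsLeftMinimalIndices (toRat L) η ↔ IsLeftMinimalIndices Rhat η) ∧
      (IsLeftMinimalIndices (toRat L) η ↔ IsLeftMinimalIndices R η)) := by
  subst hR hL hRhat
  exact mainTheorem4_general (E := F) hA hMA hMB hMC hMD (fun i => hLA.pencil (.inl i)) hMBlin
    hMClin (fun i => hLD.pencil (.inl i)) (fun i => (hLA.rowDegree_eq_one i).ge)
    (fun i => (hLD.rowDegree_eq_one i).ge) hNA hND
    (by simpa [evalAt, Polynomial.coe_aeval_eq_eval] using hfin) (by simpa using hinf)
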